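/- Let $E$ be a real Banach lattice with positive cone $E^+$, and let $E'$ be its topological dual, which is a Banach lattice under the dual norm and the order $f\le g \iff f(x)\le g(x)$ for all $x\in E^+$. An operator (bounded linear map) $T:E\to Y$ into a Banach space $Y$ is called almost Dunford–Pettis if $\|Tx_n\|\to 0$ for every weakly null sequence $(x_n)$ in $E$ that is disjoint, i.e. $|x_n|\wedge|x_m|=0$ for $n\ne m$. We say that $E$ has the weak Dunford–Pettis (wDP) property if every weakly compact operator from $E$ into an arbitrary Banach space is almost Dunford–Pettis. The following assertions are equivalent: 1. $E$ has the wDP property. 2. For all relatively weakly compact subsets $A\subset E$ and $B\subset E'$ and every $\varepsilon>0$, there exists $u\in E^+$ such that $|f|\big((|x|-u)^+\big)\le\varepsilon$ for all $x\in A$ and all $f\in B$. 3. For all relatively weakly compact subsets $A\subset E$ and $B\subset E'$ and every $\varepsilon>0$, there exists $g\in (E')^+$ such that $(|f|-g)^+(|x|)\le\varepsilon$ for all $x\in A$ and all $f\in B$. -/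

import Mathlib

open Filter Topology

universe u v

noncomputable section

namespace BanachLattice

/-! ### The topological dual of a Banach lattice as a vector lattice -/

section Dual

set_option linter.unusedSectionVars false

variable {E : Type u} [NormedAddCommGroup E] [Lattice E] [HasSolidNorm E] [IsOrderedAddMonoid E]
  [NormedSpace ℝ E] [IsOrderedModule ℝ E]

/-- The dual order: `f ≤ g` means `f x ≤ g x` for every `x` in the positive cone. -/
instance dualPartialOrder : PartialOrder (StrongDual ℝ E) where
  le f g := ∀ x : E, 0 ≤ x → f x ≤ g x
  le_refl _ _ _ := le_rfl
  le_trans _ _ _ h₁ h₂ x hx := (h₁ x hx).trans (h₂ x hx)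
  le_antisymm f g h₁ h₂ := by
    ext x
    have h : ∀ y : E, 0 ≤ y → f y = g y := fun y hy => le_antisymm (h₁ y hy) (h₂ y hy)
    rw [← posPart_sub_negPart x, map_sub, map_sub, h _ (posPart_nonneg x),
      h _ (negPart_nonneg x)]

/-- The value at `x ≥ 0` of the positive part of a functional: the supremum of `f` on `[0, x]`. -/
def posVal (f : StrongDual ℝ E) (x : E) : ℝ := sSup (f '' Set.Icc 0 x)

theorem posVal_bound (f : StrongDual ℝ E) {x y : E} (hy : y ∈ Set.Icc 0 x) :
    f y ≤ ‖f‖ * ‖x‖ := by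
  have h : ‖y‖ ≤ ‖x‖ := norm_le_norm_of_abs_le_abs (by
    rw [abs_of_nonneg hy.1, abs_of_nonneg (hy.1.trans hy.2)]; exact hy.2)
  exact (le_abs_self _).trans ((f.le_opNorm y).trans
    (mul_le_mul_of_nonneg_left h (norm_nonneg f)))

theorem le_posVal (f : StrongDual ℝ E) {x y : E} (hy : y ∈ Set.Icc 0 x) : f y ≤ posVal f x := by
  refine le_csSup ⟨‖f‖ * ‖x‖, ?_⟩ ⟨y, hy, rfl⟩
  rintro _ ⟨z, hz, rfl⟩
  exact posVal_bound f hz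

theorem posVal_le (f : StrongDual ℝ E) {x : E} (hx : 0 ≤ x) {c : ℝ}
    (h : ∀ y ∈ Set.Icc 0 x, f y ≤ c) : posVal f x ≤ c := by
  refine csSup_le ⟨f 0, 0, ⟨le_rfl, hx⟩, rfl⟩ ?_
  rintro _ ⟨z, hz, rfl⟩
  exact h z hz

theorem posVal_nonneg (f : StrongDual ℝ E) {x : E} (hx : 0 ≤ x) : 0 ≤ posVal f x := by
  have h := le_posVal f (x := x) (y := 0) ⟨le_rfl, hx⟩
  rwa [map_zero] at h

theorem posVal_add (f : StrongDual ℝ E) {x y : E} (hx : 0 ≤ x) (hy : 0 ≤ y) :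
    posVal f (x + y) = posVal f x + posVal f y := by
  apply le_antisymm
  · refine posVal_le f (add_nonneg hx hy) fun z hz => ?_
    have h₁ : z ⊓ x ∈ Set.Icc 0 x := ⟨le_inf hz.1 hx, inf_le_right⟩
    have h₂ : z - z ⊓ x ∈ Set.Icc 0 y := by
      refine ⟨sub_nonneg.2 inf_le_left, ?_⟩
      rw [sub_le_iff_le_add', ← sub_le_iff_le_add]
      exact le_inf (sub_le_self _ hy) (sub_le_iff_le_add.2 hz.2)
    have h := add_le_add (le_posVal f h₁) (le_posVal f h₂)
    rwa [← map_add, add_sub_cancel] at h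
  · rw [← le_sub_iff_add_le]
    refine posVal_le f hx fun a ha => ?_
    rw [le_sub_comm]
    refine posVal_le f hy fun b hb => ?_
    rw [le_sub_iff_add_le', ← map_add]
    exact le_posVal f ⟨add_nonneg ha.1 hb.1, add_le_add ha.2 hb.2⟩

theorem posVal_smul (f : StrongDual ℝ E) {c : ℝ} (hc : 0 ≤ c) {x : E} (hx : 0 ≤ x) :
    posVal f (c • x) = c * posVal f x := by
  have key : ∀ {c : ℝ}, 0 < c → ∀ {x : E}, 0 ≤ x → c * posVal f x ≤ posVal f (c • x) := by
    intro c hc x hx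
    rw [← le_div_iff₀' hc]
    refine posVal_le f hx fun a ha => ?_
    rw [le_div_iff₀' hc, ← smul_eq_mul, ← map_smul]
    exact le_posVal f ⟨smul_nonneg hc.le ha.1, smul_le_smul_of_nonneg_left ha.2 hc.le⟩
  rcases hc.eq_or_lt with rfl | hc
  · have h := posVal_add f (le_refl (0 : E)) (le_refl (0 : E))
    rw [add_zero] at h
    rw [zero_smul, zero_mul]
    linarith
  · refine le_antisymm ?_ (key hc hx)
    have h := key (inv_pos.2 hc) (smul_nonneg hc.le hx)
    rwa [inv_smul_smul₀ hc.ne', inv_mul_le_iff₀ hc] at h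

theorem posVal_sub_eq (f : StrongDual ℝ E) {x a b : E} (ha : 0 ≤ a) (hb : 0 ≤ b)
    (h : x = a - b) : posVal f x⁺ - posVal f x⁻ = posVal f a - posVal f b := by
  have h₁ : x⁺ + b = a + x⁻ := by
    have h₂ := posPart_sub_negPart x
    rw [h] at h₂ ⊢
    rw [← sub_eq_sub_iff_add_eq_add, h₂]
  have h₃ := congrArg (posVal f) h₁
  rw [posVal_add f (posPart_nonneg x) hb, posVal_add f ha (negPart_nonneg x)] at h₃
  linarith

/-- The positive part `f ∨ 0` of a functional, by the Riesz–Kantorovich formula on the positive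
cone and `x = x⁺ - x⁻` elsewhere. -/
def dualPos (f : StrongDual ℝ E) : StrongDual ℝ E :=
  LinearMap.mkContinuous
    { toFun := fun x => posVal f x⁺ - posVal f x⁻
      map_add' := by
        intro x y
        rw [posVal_sub_eq f (add_nonneg (posPart_nonneg x) (posPart_nonneg y))
          (add_nonneg (negPart_nonneg x) (negPart_nonneg y)) (x := x + y),
          posVal_add f (posPart_nonneg x) (posPart_nonneg y),
          posVal_add f (negPart_nonneg x) (negPart_nonneg y)]
        · ring
        · rw [add_sub_add_comm, posPart_sub_negPart, posPart_sub_negPart]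
      map_smul' := by
        intro c x
        rw [RingHom.id_apply, smul_eq_mul]
        rcases le_total 0 c with hc | hc
        · rw [posVal_sub_eq f (smul_nonneg hc (posPart_nonneg x))
            (smul_nonneg hc (negPart_nonneg x)) (x := c • x),
            posVal_smul f hc (posPart_nonneg x), posVal_smul f hc (negPart_nonneg x)]
          · ring
          · rw [← smul_sub, posPart_sub_negPart]
        · have hc' : 0 ≤ -c := neg_nonneg.2 hc
          rw [posVal_sub_eq f (smul_nonneg hc' (negPart_nonneg x))
            (smul_nonneg hc' (posPart_nonneg x)) (x := c • x),
            posVal_smul f hc' (posPart_nonneg x), posVal_smul f hc' (negPart_nonneg x)]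
          · ring
          · rw [← smul_sub, neg_smul, ← smul_neg, neg_sub, posPart_sub_negPart] }
    ‖f‖ (by
      intro x
      have h₁ : posVal f x⁺ ≤ ‖f‖ * ‖x‖ := by
        refine posVal_le f (posPart_nonneg x) fun y hy => posVal_bound f ⟨hy.1, hy.2.trans ?_⟩ |>.trans
          (le_of_eq (congrArg _ (norm_abs_eq_norm x)))
        exact sup_le (le_abs_self x) (abs_nonneg x)
      have h₂ : posVal f x⁻ ≤ ‖f‖ * ‖x‖ := by
        refine posVal_le f (negPart_nonneg x) fun y hy => posVal_bound f ⟨hy.1, hy.2.trans ?_⟩ |>.trans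
          (le_of_eq (congrArg _ (norm_abs_eq_norm x)))
        exact sup_le (neg_le_abs x) (abs_nonneg x)
      have h₃ := posVal_nonneg f (posPart_nonneg x)
      have h₄ := posVal_nonneg f (negPart_nonneg x)
      change |posVal f x⁺ - posVal f x⁻| ≤ _
      rw [abs_le]
      constructor <;> linarith)

theorem dualPos_apply (f : StrongDual ℝ E) {x : E} (hx : 0 ≤ x) : dualPos f x = posVal f x := by
  have h := posVal_sub_eq f hx le_rfl (sub_zero x).symm
  have h₀ := posVal_smul f le_rfl (le_refl (0 : E))
  rw [zero_smul, zero_mul] at h₀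
  rw [h₀, sub_zero] at h
  exact h

theorem dualPos_nonneg (f : StrongDual ℝ E) {x : E} (hx : 0 ≤ x) : 0 ≤ dualPos f x := by
  rw [dualPos_apply f hx]; exact posVal_nonneg f hx

theorem le_dualPos (f : StrongDual ℝ E) {x : E} (hx : 0 ≤ x) : f x ≤ dualPos f x := by
  rw [dualPos_apply f hx]; exact le_posVal f ⟨hx, le_rfl⟩

theorem dualPos_le {f g : StrongDual ℝ E} (hfg : ∀ x : E, 0 ≤ x → f x ≤ g x)
    (hg : ∀ x : E, 0 ≤ x → 0 ≤ g x) {x : E} (hx : 0 ≤ x) : dualPos f x ≤ g x := by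
  rw [dualPos_apply f hx]
  refine posVal_le f hx fun y hy => (hfg y hy.1).trans ?_
  have h := hg (x - y) (sub_nonneg.2 hy.2)
  rw [map_sub] at h
  linarith

/-- The lattice operations of the dual order. -/
instance dualLattice : Lattice (StrongDual ℝ E) where
  __ := dualPartialOrder
  sup f g := g + dualPos (f - g)
  inf f g := f - dualPos (f - g)
  le_sup_left f g x hx := by
    have h := le_dualPos (f - g) hx
    change f x ≤ g x + dualPos (f - g) x
    change f x - g x ≤ _ at h
    linarith
  le_sup_right f g x hx := by
    have h := dualPos_nonneg (f - g) hx
    change g x ≤ g x + dualPos (f - g) x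
    linarith
  sup_le f g k hf hg x hx := by
    have h := dualPos_le (f := f - g) (g := k - g)
      (fun y hy => sub_le_sub_right (hf y hy) (g y)) (fun y hy => sub_nonneg.2 (hg y hy)) hx
    change g x + dualPos (f - g) x ≤ k x
    change _ ≤ k x - g x at h
    linarith
  inf_le_left f g x hx := by
    have h := dualPos_nonneg (f - g) hx
    change f x - dualPos (f - g) x ≤ f x
    linarith
  inf_le_right f g x hx := by
    have h := le_dualPos (f - g) hx
    change f x - dualPos (f - g) x ≤ g x
    change f x - g x ≤ _ at h
    linarith
  le_inf k f g hf hg x hx := by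
    have h := dualPos_le (f := f - g) (g := f - k)
      (fun y hy => sub_le_sub_left (hg y hy) (f y)) (fun y hy => sub_nonneg.2 (hf y hy)) hx
    change k x ≤ f x - dualPos (f - g) x
    change _ ≤ f x - k x at h
    linarith

end Dual

/-! ### Weak topology notions -/

section Weak

variable {X : Type u} [NormedAddCommGroup X] [NormedSpace ℝ X]

/-- The sequence `x` converges to `0` for `σ(X, X')`. -/
def IsWeaklyNull (x : ℕ → X) : Prop :=
  ∀ φ : StrongDual ℝ X, Tendsto (fun n => φ (x n)) atTop (𝓝 0)

/-- `A` is relatively weakly compact: its closure for `σ(X, X')` is `σ(X, X')`-compact. -/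
def IsRelativelyWeaklyCompact (A : Set X) : Prop :=
  IsCompact (closure (toWeakSpace ℝ X '' A))

/-- A bounded operator is weakly compact if it maps the closed unit ball to a relatively weakly
compact set. -/
def IsWeaklyCompactOperator {Y : Type v} [NormedAddCommGroup Y] [NormedSpace ℝ Y]
    (T : X →L[ℝ] Y) : Prop :=
  IsRelativelyWeaklyCompact (T '' Metric.closedBall 0 1)

end Weak

/-! ### The weak Dunford–Pettis property -/

section WeakDunfordPettis

variable {E : Type u} [NormedAddCommGroup E] [Lattice E] [NormedSpace ℝ E]

/-- The terms of the sequence are pairwise disjoint: `|x n| ∧ |x m| = 0` for `n ≠ m`. -/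
def IsDisjointSeq (x : ℕ → E) : Prop :=
  Pairwise fun n m => |x n| ⊓ |x m| = 0

/-- An operator on `E` is almost Dunford–Pettis if it maps disjoint weakly null sequences to norm
null ones. -/
def IsAlmostDunfordPettis {Y : Type v} [NormedAddCommGroup Y] [NormedSpace ℝ Y]
    (T : E →L[ℝ] Y) : Prop :=
  ∀ x : ℕ → E, IsDisjointSeq x → IsWeaklyNull x → Tendsto (fun n => ‖T (x n)‖) atTop (𝓝 0)

variable (E) in
/-- `E` has the weak Dunford–Pettis property: every weakly compact operator from `E` to a Banach
space is almost Dunford–Pettis. -/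
def HasWeakDunfordPettisProperty : Prop :=
  ∀ (Y : Type v) [NormedAddCommGroup Y] [NormedSpace ℝ Y] [CompleteSpace Y] (T : E →L[ℝ] Y),
    IsWeaklyCompactOperator T → IsAlmostDunfordPettis T

end WeakDunfordPettis

end BanachLattice

end

namespace BanachLattice

section WeakTopology

variable {X : Type u} [NormedAddCommGroup X] [NormedSpace ℝ X]

theorem continuous_weakSpace_eval (φ : StrongDual ℝ X) :
    Continuous fun x : WeakSpace ℝ X => φ ((toWeakSpace ℝ X).symm x) :=
  WeakBilin.eval_continuous (topDualPairing ℝ X).flip φ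

theorem continuous_weakSpace_rng {K : Type*} [TopologicalSpace K] {S : K → WeakSpace ℝ X}
    (h : ∀ φ : StrongDual ℝ X, Continuous fun k => φ ((toWeakSpace ℝ X).symm (S k))) :
    Continuous S :=
  WeakBilin.continuous_of_continuous_eval (topDualPairing ℝ X).flip h

theorem IsRelativelyWeaklyCompact.of_subset_image {K : Type*} [TopologicalSpace K] {s : Set K}
    (hs : IsCompact s) {S : K → X} (h : ∀ φ : StrongDual ℝ X, Continuous fun k => φ (S k))
    {A : Set X} (hA : A ⊆ S '' s) : IsRelativelyWeaklyCompact A := by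
  have hS : Continuous fun k => toWeakSpace ℝ X (S k) := continuous_weakSpace_rng h
  have hc : IsCompact ((fun k => toWeakSpace ℝ X (S k)) '' s) := hs.image hS
  refine hc.of_isClosed_subset isClosed_closure (closure_minimal ?_ hc.isClosed)
  rintro _ ⟨a, ha, rfl⟩
  obtain ⟨k, hk, rfl⟩ := hA ha
  exact ⟨k, hk, rfl⟩

theorem IsRelativelyWeaklyCompact.exists_norm_le {A : Set X} (hA : IsRelativelyWeaklyCompact A) :
    ∃ C : ℝ, ∀ x ∈ A, ‖x‖ ≤ C := by
  have h : ∀ φ : StrongDual ℝ X, ∃ C, ∀ x : A, ‖NormedSpace.inclusionInDoubleDual ℝ X x φ‖ ≤ C := by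
    intro φ
    obtain ⟨C, hC⟩ := hA.exists_bound_of_continuousOn (continuous_weakSpace_eval φ).continuousOn
    exact ⟨C, fun x => hC _ (subset_closure ⟨x, x.2, rfl⟩)⟩
  obtain ⟨C, hC⟩ := banach_steinhaus h
  refine ⟨C, fun x hx => ?_⟩
  have h₁ := hC ⟨x, hx⟩
  rwa [show ‖NormedSpace.inclusionInDoubleDual ℝ X x‖ = ‖x‖ from
    (NormedSpace.inclusionInDoubleDualLi ℝ).norm_map x] at h₁

theorem IsWeaklyNull.isRelativelyWeaklyCompact_range {x : ℕ → X} (hx : IsWeaklyNull x) :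
    IsRelativelyWeaklyCompact (Set.range x) := by
  have h : Tendsto (fun n => toWeakSpace ℝ X (x n)) atTop (𝓝 (toWeakSpace ℝ X 0)) := by
    refine (WeakBilin.isEmbedding (B := (topDualPairing ℝ X).flip) ?_).tendsto_nhds_iff.2 ?_
    · intro a b hab
      exact (SeparatingDual.eq_iff_forall_dual_eq (R := ℝ)).2 fun f => DFunLike.congr_fun hab f
    · refine tendsto_pi_nhds.2 fun φ => ?_
      have h := hx φ
      rw [← map_zero φ] at h
      exact h
  refine h.isCompact_insert_range.of_isClosed_subset isClosed_closure
    (closure_minimal ?_ h.isCompact_insert_range.isClosed)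
  rintro _ ⟨_, ⟨n, rfl⟩, rfl⟩
  exact Or.inr ⟨n, rfl⟩

/-- Countably many functionals separate the points of a separable subspace. -/
theorem exists_seq_dual_separating (Z : Submodule ℝ X) [TopologicalSpace.SeparableSpace Z] :
    ∃ φ : ℕ → StrongDual ℝ X, ∀ z ∈ Z, ∀ w ∈ Z, (∀ k, φ k z = φ k w) → z = w := by
  choose φ h₁ h₂ using fun k => exists_dual_vector'' ℝ ((TopologicalSpace.denseSeq Z k : Z) : X)
  refine ⟨φ, fun z hz w hw h => ?_⟩
  by_contra hne
  have hd : 0 < ‖z - w‖ := norm_pos_iff.2 (sub_ne_zero.2 hne)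
  obtain ⟨k, hk⟩ := (TopologicalSpace.denseRange_denseSeq Z).exists_dist_lt
    (⟨z - w, Z.sub_mem hz hw⟩ : Z) (half_pos hd)
  let d : X := (TopologicalSpace.denseSeq Z k).1
  have hk' : ‖(z - w) - d‖ < ‖z - w‖ / 2 := by
    rw [Subtype.dist_eq, dist_eq_norm] at hk
    exact hk
  have h₃ : φ k (z - w) = 0 := by rw [map_sub, h k, sub_self]
  have h₄ : ‖d‖ ≤ ‖(z - w) - d‖ := by
    have h₅ : φ k d = -φ k ((z - w) - d) := by rw [map_sub, h₃, zero_sub, neg_neg]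
    have h₆ : φ k d = ‖d‖ := h₂ k
    have h₇ := (φ k).le_of_opNorm_le (h₁ k) ((z - w) - d)
    rw [← h₆, h₅]
    rw [one_mul] at h₇
    exact (neg_le_abs _).trans h₇
  have h₅ := norm_sub_norm_le (z - w) d
  linarith

/-- Šmulian's theorem: relatively weakly compact sets are relatively weakly sequentially
compact. -/
theorem IsRelativelyWeaklyCompact.exists_subseq {A : Set X} (hA : IsRelativelyWeaklyCompact A)
    {x : ℕ → X} (hx : ∀ n, x n ∈ A) :
    ∃ (a : X) (ψ : ℕ → ℕ), StrictMono ψ ∧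
      ∀ f : StrongDual ℝ X, Tendsto (fun n => f (x (ψ n))) atTop (𝓝 (f a)) := by
  let Z : Submodule ℝ X := (Submodule.span ℝ (Set.range x)).topologicalClosure
  have hsep : TopologicalSpace.IsSeparable (Z : Set X) := by
    have h := ((Set.countable_range x).isSeparable.span (R := ℝ)).closure
    exact h
  have : TopologicalSpace.SeparableSpace Z := hsep.separableSpace
  obtain ⟨φ, hφ⟩ := exists_seq_dual_separating Z
  let K : Set (WeakSpace ℝ X) := closure (Set.range fun n => toWeakSpace ℝ X (x n))
  have hK : IsCompact K := by
    refine hA.of_isClosed_subset isClosed_closure (closure_mono ?_)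
    rintro _ ⟨n, rfl⟩
    exact ⟨x n, hx n, rfl⟩
  have hKZ : ∀ k ∈ K, (toWeakSpace ℝ X).symm k ∈ Z := by
    have hconv : Convex ℝ (Z : Set X) := Z.convex
    have hcl : closure (toWeakSpace ℝ X '' (Z : Set X)) = toWeakSpace ℝ X '' (Z : Set X) := by
      rw [← hconv.toWeakSpace_closure ℝ, IsClosed.closure_eq]
      exact Submodule.isClosed_topologicalClosure _
    intro k hk
    have h : k ∈ toWeakSpace ℝ X '' (Z : Set X) := by
      rw [← hcl]
      refine closure_mono ?_ hk
      rintro _ ⟨n, rfl⟩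
      exact ⟨x n, Submodule.le_topologicalClosure _ (Submodule.subset_span ⟨n, rfl⟩), rfl⟩
    obtain ⟨z, hz, rfl⟩ := h
    exact hz
  have : CompactSpace K := isCompact_iff_compactSpace.1 hK
  have : TopologicalSpace.MetrizableSpace K :=
    Metric.PiNatEmbed.TopologicalSpace.MetrizableSpace.of_countable_separating
      (fun n (k : K) => φ n ((toWeakSpace ℝ X).symm k))
      (fun n => (continuous_weakSpace_eval (φ n)).comp continuous_subtype_val) (by
        intro a b hab
        by_contra! hne
        exact hab (Subtype.ext ((toWeakSpace ℝ X).symm.injective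
          (hφ _ (hKZ _ a.2) _ (hKZ _ b.2) hne))))
  obtain ⟨a, ψ, hψ, ha⟩ := CompactSpace.tendsto_subseq
    (fun n => (⟨toWeakSpace ℝ X (x n), subset_closure ⟨n, rfl⟩⟩ : K))
  refine ⟨(toWeakSpace ℝ X).symm a, ψ, hψ, fun f => ?_⟩
  exact (((continuous_weakSpace_eval f).comp continuous_subtype_val).tendsto a).comp ha

end WeakTopology

section WeaklyCompactOperators

variable {X : Type u} [NormedAddCommGroup X] [NormedSpace ℝ X]

/-- A functional dominated by a convex set of functionals that is compact for pointwise convergence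
belongs to that set. -/
theorem mem_image_of_forall_le {V W K : Type*} [AddCommGroup V] [Module ℝ V] [AddCommGroup W]
    [Module ℝ W] (B : V →ₗ[ℝ] W →ₗ[ℝ] ℝ) (hB : Function.Injective B) [TopologicalSpace K]
    {s : Set K} (hs : IsCompact s) {S : K → V} (hS : ∀ w, Continuous fun k => B (S k) w)
    (hconv : Convex ℝ (S '' s)) {v : V}
    (hv : ∀ (w : W) (c : ℝ), (∀ k ∈ s, B (S k) w ≤ c) → B v w ≤ c) : v ∈ S '' s := by
  by_contra hmem
  let S' : K → WeakBilin B := S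
  have hS' : Continuous S' := WeakBilin.continuous_of_continuous_eval B hS
  have : T2Space (WeakBilin B) := (WeakBilin.isEmbedding hB).t2Space
  obtain ⟨F, c, hs, hc⟩ := geometric_hahn_banach_closed_point (E := WeakBilin B) (s := S' '' s)
    (x := v) hconv (hs.image hS').isClosed hmem
  obtain ⟨w, rfl⟩ := LinearMap.dualEmbedding_surjective B F
  exact (hv w c fun k hk => (hs (S' k) ⟨k, hk, rfl⟩).le).not_gt hc

/-- The biadjoint of a weakly compact operator takes its values in the range space. -/
theorem IsWeaklyCompactOperator.exists_biadjoint_eq {Y : Type v} [NormedAddCommGroup Y]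
    [NormedSpace ℝ Y] {T : X →L[ℝ] Y} (hT : IsWeaklyCompactOperator T)
    (Φ : StrongDual ℝ (StrongDual ℝ X)) (hΦ : ∀ f, Φ f ≤ ‖f‖) :
    ∃ y : Y, ∀ g : StrongDual ℝ Y, Φ (g ∘L T) = g y := by
  let K : Set (WeakSpace ℝ Y) := closure (toWeakSpace ℝ Y '' (T '' Metric.closedBall 0 1))
  have hK : IsCompact K := hT
  have hKc : Convex ℝ K := by
    refine Convex.closure ?_
    exact ((convex_closedBall (0 : X) 1).linear_image (T : X →ₗ[ℝ] Y)).linear_image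
      (toWeakSpace ℝ Y : Y →ₗ[ℝ] WeakSpace ℝ Y)
  let J : WeakSpace ℝ Y →ₗ[ℝ] StrongDual ℝ (StrongDual ℝ Y) :=
    (NormedSpace.inclusionInDoubleDual ℝ Y : Y →ₗ[ℝ] StrongDual ℝ (StrongDual ℝ Y)) ∘ₗ
      ((toWeakSpace ℝ Y).symm : WeakSpace ℝ Y →ₗ[ℝ] Y)
  obtain ⟨k, -, hk⟩ := mem_image_of_forall_le (ContinuousLinearMap.coeLM ℝ)
    ContinuousLinearMap.coe_injective hK (S := J) (fun g => continuous_weakSpace_eval g)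
    (hKc.linear_image J) (v := Φ.comp (ContinuousLinearMap.precomp ℝ T)) (fun g c hg => by
      have h₂ : ∀ x : X, ‖x‖ ≤ 1 → (g ∘L T) x ≤ c := fun x hx =>
        hg (toWeakSpace ℝ Y (T x)) (subset_closure ⟨T x, ⟨x, by simpa using hx, rfl⟩, rfl⟩)
      have h₃ : ‖g ∘L T‖ ≤ c := by
        have h0 : 0 ≤ c := by simpa using h₂ 0 (by simp)
        refine ContinuousLinearMap.opNorm_le_of_unit_norm h0 fun x hx => ?_
        rw [Real.norm_eq_abs, abs_le]
        have := h₂ (-x) (by rw [norm_neg, hx])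
        rw [map_neg] at this
        exact ⟨by linarith, h₂ x hx.le⟩
      exact (hΦ (g ∘L T)).trans h₃)
  refine ⟨(toWeakSpace ℝ Y).symm k, fun g => ?_⟩
  have h : J k g = Φ (g ∘L T) := by rw [hk]; rfl
  exact h.symm

/-- Gantmacher's theorem: the adjoint of a weakly compact operator is weakly compact. -/
theorem IsWeaklyCompactOperator.adjoint {Y : Type v} [NormedAddCommGroup Y]
    [NormedSpace ℝ Y] {T : X →L[ℝ] Y} (hT : IsWeaklyCompactOperator T) :
    IsRelativelyWeaklyCompact ((fun g : StrongDual ℝ Y => g ∘L T) '' Metric.closedBall 0 1) := by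
  have hc := WeakDual.isCompact_closedBall (𝕜 := ℝ) (0 : StrongDual ℝ Y) 1
  refine IsRelativelyWeaklyCompact.of_subset_image hc
    (S := fun g => (WeakDual.toStrongDual g) ∘L T) (fun Φ => ?_) ?_
  · have hc : 0 < ‖Φ‖ + 1 := by positivity
    obtain ⟨y, hy⟩ := hT.exists_biadjoint_eq ((‖Φ‖ + 1)⁻¹ • Φ) (fun f => by
      change (‖Φ‖ + 1)⁻¹ * Φ f ≤ ‖f‖
      rw [inv_mul_le_iff₀ hc]
      have h₁ : Φ f ≤ ‖Φ‖ * ‖f‖ := (le_abs_self _).trans (Φ.le_opNorm f)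
      nlinarith [norm_nonneg f])
    have h : ∀ g : StrongDual ℝ Y, Φ (g ∘L T) = (‖Φ‖ + 1) * g y := fun g => by
      rw [← hy]
      change _ = (‖Φ‖ + 1) * ((‖Φ‖ + 1)⁻¹ * Φ (g ∘L T))
      rw [mul_inv_cancel_left₀ hc.ne']
    have h' : (fun g : WeakDual ℝ Y => Φ (WeakDual.toStrongDual g ∘L T)) =
        fun g => (‖Φ‖ + 1) * g y := funext fun g => h _
    rw [h']
    exact continuous_const.mul (WeakDual.eval_continuous y)
  · rintro _ ⟨g, hg, rfl⟩
    exact ⟨StrongDual.toWeakDual g, hg, rfl⟩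

end WeaklyCompactOperators

section NullSequences

open scoped ZeroAtInfty

/-- A null sequence as an element of `c₀`. -/
def nullSeq (c : ℕ → ℝ) (hc : Tendsto c atTop (𝓝 0)) : C₀(ℕ, ℝ) where
  toFun := c
  continuous_toFun := continuous_of_discreteTopology
  zero_at_infty' := by rwa [cocompact_eq_cofinite, Nat.cofinite_eq_atTop]

theorem abs_apply_le_norm (y : C₀(ℕ, ℝ)) (n : ℕ) : |y n| ≤ ‖y‖ := by
  rw [← ZeroAtInftyContinuousMap.norm_toBCF_eq_norm]
  exact y.toBCF.norm_coe_le_norm n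

theorem norm_le_of_abs_apply_le {y : C₀(ℕ, ℝ)} {C : ℝ} (hC : 0 ≤ C) (h : ∀ n, |y n| ≤ C) :
    ‖y‖ ≤ C := by
  rw [← ZeroAtInftyContinuousMap.norm_toBCF_eq_norm]
  exact (BoundedContinuousFunction.norm_le hC).2 h

/-- The first `N` terms of a sequence, as an element of `c₀`. -/
def truncSeq (N : ℕ) (c : ℕ → ℝ) : C₀(ℕ, ℝ) :=
  nullSeq (fun n => if n < N then c n else 0) <| tendsto_const_nhds.congr' <| by
    filter_upwards [eventually_ge_atTop N] with n hn
    rw [if_neg hn.not_gt]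

theorem truncSeq_apply (N : ℕ) (c : ℕ → ℝ) (n : ℕ) :
    truncSeq N c n = if n < N then c n else 0 := rfl

/-- The `k`-th unit vector of `c₀`. -/
def unitSeq (k : ℕ) : C₀(ℕ, ℝ) := truncSeq (k + 1) (Pi.single k 1)

theorem unitSeq_apply (k n : ℕ) : unitSeq k n = if n = k then 1 else 0 := by
  rw [unitSeq, truncSeq_apply, Pi.single_apply]
  split_ifs <;> first | rfl | omega

theorem map_truncSeq (φ : StrongDual ℝ C₀(ℕ, ℝ)) (N : ℕ) (c : ℕ → ℝ) :
    φ (truncSeq N c) = ∑ k ∈ Finset.range N, c k * φ (unitSeq k) := by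
  induction N with
  | zero =>
    have h : truncSeq 0 c = 0 := by ext n; simp [truncSeq_apply]
    rw [h, map_zero, Finset.sum_range_zero]
  | succ N ih =>
    have h : truncSeq (N + 1) c = truncSeq N c + c N • unitSeq N := by
      ext n
      rw [ZeroAtInftyContinuousMap.add_apply, ZeroAtInftyContinuousMap.smul_apply, truncSeq_apply,
        truncSeq_apply, unitSeq_apply]
      rcases lt_trichotomy n N with h | rfl | h
      · simp [h, h.ne, h.trans (Nat.lt_succ_self N)]
      · simp
      · simp [h.not_gt, h.ne', Nat.not_lt.2 (Nat.succ_le_of_lt h)]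
    rw [h, map_add, map_smul, ih, Finset.sum_range_succ, smul_eq_mul]

theorem summable_abs_map_unitSeq (φ : StrongDual ℝ C₀(ℕ, ℝ)) :
    Summable fun k => |φ (unitSeq k)| := by
  refine summable_of_sum_range_le (c := ‖φ‖) (fun _ => abs_nonneg _) fun N => ?_
  have h : ∑ k ∈ Finset.range N, |φ (unitSeq k)| =
      φ (truncSeq N fun k => if 0 ≤ φ (unitSeq k) then 1 else -1) := by
    rw [map_truncSeq]
    refine Finset.sum_congr rfl fun k _ => ?_
    split_ifs with h
    · rw [abs_of_nonneg h, one_mul]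
    · rw [abs_of_neg (not_le.1 h), neg_one_mul]
  rw [h]
  refine (le_abs_self _).trans ((φ.le_opNorm _).trans
    (mul_le_of_le_one_right (norm_nonneg _) (norm_le_of_abs_apply_le zero_le_one fun n => ?_)))
  rw [truncSeq_apply]
  split_ifs <;> simp

theorem map_eq_tsum (φ : StrongDual ℝ C₀(ℕ, ℝ)) (y : C₀(ℕ, ℝ)) :
    φ y = ∑' k, y k * φ (unitSeq k) := by
  have hs : Summable fun k => y k * φ (unitSeq k) :=
    Summable.of_norm_bounded ((summable_abs_map_unitSeq φ).mul_left ‖y‖) fun k => by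
      rw [norm_mul]
      exact mul_le_mul_of_nonneg_right (abs_apply_le_norm y k) (abs_nonneg _)
  have h₁ : Tendsto (fun N => truncSeq N y) atTop (𝓝 y) := by
    have hy : Tendsto (fun n => y n) atTop (𝓝 0) := by
      have h := y.zero_at_infty'
      rwa [cocompact_eq_cofinite, Nat.cofinite_eq_atTop] at h
    rw [Metric.tendsto_atTop]
    intro ε hε
    obtain ⟨N, hN⟩ := Metric.tendsto_atTop.1 hy (ε / 2) (half_pos hε)
    refine ⟨N, fun m hm => ?_⟩
    rw [dist_eq_norm]
    refine (norm_le_of_abs_apply_le (half_pos hε).le fun n => ?_).trans_lt (half_lt_self hε)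
    rw [ZeroAtInftyContinuousMap.sub_apply, truncSeq_apply]
    split_ifs with h
    · rw [sub_self, abs_zero]; exact (half_pos hε).le
    · have h₂ := hN n (by omega)
      rw [Real.dist_eq, sub_zero] at h₂
      rw [zero_sub, abs_neg]
      exact h₂.le
  have h₂ := (φ.continuous.tendsto y).comp h₁
  have h₃ : (φ ∘ fun N => truncSeq N y) =
      fun N => ∑ k ∈ Finset.range N, y k * φ (unitSeq k) := funext fun N => map_truncSeq φ N y
  rw [h₃] at h₂
  exact tendsto_nhds_unique h₂ hs.hasSum.tendsto_sum_nat

variable {X : Type u} [NormedAddCommGroup X] [NormedSpace ℝ X]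

/-- The operator into `c₀` with coordinate functionals `f n`. -/
noncomputable def nullSeqOperator (f : ℕ → StrongDual ℝ X) (hf : ∀ x, Tendsto (fun n => f n x) atTop (𝓝 0))
    (C : ℝ) (hC : ∀ n, ‖f n‖ ≤ C) : X →L[ℝ] C₀(ℕ, ℝ) :=
  LinearMap.mkContinuous
    { toFun := fun x => nullSeq (fun n => f n x) (hf x)
      map_add' := fun x y => by ext n; exact map_add (f n) x y
      map_smul' := fun c x => by ext n; exact map_smul (f n) c x }
    C fun x => by
      refine norm_le_of_abs_apply_le ?_ fun n => ?_
      · exact mul_nonneg ((norm_nonneg _).trans (hC 0)) (norm_nonneg x)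
      · exact (f n).le_of_opNorm_le (hC n) x

/-- A weakly null sequence of functionals defines a weakly compact operator into `c₀`. -/
theorem IsWeaklyNull.isWeaklyCompactOperator {f : ℕ → StrongDual ℝ X} (hf : IsWeaklyNull f)
    (hf' : ∀ x, Tendsto (fun n => f n x) atTop (𝓝 0)) {C : ℝ} (hC : ∀ n, ‖f n‖ ≤ C)
    {Y : Type v} [NormedAddCommGroup Y] [NormedSpace ℝ Y] (e : C₀(ℕ, ℝ) →L[ℝ] Y) :
    IsWeaklyCompactOperator (e ∘L nullSeqOperator f hf' C hC) := by
  let K : Set (WeakDual ℝ (StrongDual ℝ X)) :=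
    WeakDual.toStrongDual ⁻¹' Metric.closedBall (0 : StrongDual ℝ (StrongDual ℝ X)) 1
  have hK : IsCompact K := WeakDual.isCompact_closedBall (𝕜 := ℝ) (E := StrongDual ℝ X) 0 1
  have : CompactSpace K := isCompact_iff_compactSpace.1 hK
  refine IsRelativelyWeaklyCompact.of_subset_image (K := K) isCompact_univ
    (S := fun Φ => e (nullSeq (fun n => Φ.1 (f n)) (hf (WeakDual.toStrongDual Φ.1))))
    (fun φ => ?_) ?_
  · have h : ∀ Φ : K, φ (e (nullSeq (fun n => Φ.1 (f n)) (hf (WeakDual.toStrongDual Φ.1)))) =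
        ∑' k, Φ.1 (f k) * (φ ∘L e) (unitSeq k) := fun Φ => map_eq_tsum (φ ∘L e) _
    simp_rw [h]
    refine continuous_tsum (fun k => ?_) ((summable_abs_map_unitSeq (φ ∘L e)).mul_left C)
      fun k Φ => ?_
    · exact ((WeakDual.eval_continuous (f k)).comp continuous_subtype_val).mul continuous_const
    · rw [norm_mul]
      refine mul_le_mul_of_nonneg_right ?_ (abs_nonneg _)
      have h₁ : ‖WeakDual.toStrongDual Φ.1‖ ≤ 1 := by
        have h₂ : WeakDual.toStrongDual Φ.1 ∈
            Metric.closedBall (0 : StrongDual ℝ (StrongDual ℝ X)) 1 := Φ.2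
        exact (mem_closedBall_zero_iff (E := StrongDual ℝ (StrongDual ℝ X))).1 h₂
      have h₃ := (WeakDual.toStrongDual Φ.1).le_of_opNorm_le h₁ (f k)
      rw [one_mul] at h₃
      exact h₃.trans (hC k)
  · rintro _ ⟨x, hx, rfl⟩
    refine ⟨⟨StrongDual.toWeakDual (NormedSpace.inclusionInDoubleDual ℝ X x), ?_⟩,
      Set.mem_univ _, rfl⟩
    change NormedSpace.inclusionInDoubleDual ℝ X x ∈ Metric.closedBall 0 1
    rw [mem_closedBall_zero_iff] at hx
    exact (mem_closedBall_zero_iff (E := StrongDual ℝ (StrongDual ℝ X))).2 <|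
      (NormedSpace.double_dual_bound ℝ X x).trans hx

end NullSequences

section

variable {E : Type u} [NormedAddCommGroup E] [Lattice E] [NormedSpace ℝ E]

open scoped ZeroAtInfty in
/-- In a space with the weak Dunford–Pettis property, weakly null sequences of functionals
evaluate to null sequences along disjoint weakly null sequences. -/
theorem HasWeakDunfordPettisProperty.tendsto_eval (hE : HasWeakDunfordPettisProperty.{u, v} E)
    {f : ℕ → StrongDual ℝ E} (hf : IsWeaklyNull f) {x : ℕ → E} (hd : IsDisjointSeq x)
    (hx : IsWeaklyNull x) : Tendsto (fun n => f n (x n)) atTop (𝓝 0) := by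
  have hf' : ∀ x, Tendsto (fun n => f n x) atTop (𝓝 0) := fun x =>
    hf (NormedSpace.inclusionInDoubleDual ℝ E x)
  obtain ⟨C, hC⟩ := hf.isRelativelyWeaklyCompact_range.exists_norm_le
  have hC' : ∀ n, ‖f n‖ ≤ C := fun n => hC _ ⟨n, rfl⟩
  let e : C₀(ℕ, ℝ) ≃L[ℝ] ULift.{v} C₀(ℕ, ℝ) := ContinuousLinearEquiv.ulift.symm
  have h := hE (ULift.{v} C₀(ℕ, ℝ)) _
    (hf.isWeaklyCompactOperator hf' hC' (e : C₀(ℕ, ℝ) →L[ℝ] ULift.{v} C₀(ℕ, ℝ))) x hd hx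
  refine squeeze_zero_norm (fun n => ?_) h
  exact abs_apply_le_norm (nullSeqOperator f hf' C hC' (x n)) n

end

section DualBanachLattice

set_option linter.unusedSectionVars false

variable {E : Type u} [NormedAddCommGroup E] [Lattice E] [HasSolidNorm E] [IsOrderedAddMonoid E]
  [NormedSpace ℝ E] [IsOrderedModule ℝ E]

instance : IsOrderedAddMonoid (StrongDual ℝ E) where
  add_le_add_left _ _ h k x hx := add_le_add_left (h x hx) (k x)

instance : IsOrderedModule ℝ (StrongDual ℝ E) where
  smul_le_smul_of_nonneg_left _ hc _ _ h x hx := mul_le_mul_of_nonneg_left (h x hx) hc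
  smul_le_smul_of_nonneg_right _ hf _ _ h x hx := mul_le_mul_of_nonneg_right h (hf x hx)

theorem map_mono_of_nonneg {f : StrongDual ℝ E} (hf : 0 ≤ f) {x y : E} (h : x ≤ y) : f x ≤ f y := by
  have h₁ : (0 : ℝ) ≤ f (y - x) := hf _ (sub_nonneg.2 h)
  rw [map_sub] at h₁
  linarith

theorem abs_map_le (f : StrongDual ℝ E) (x : E) : |f x| ≤ |f| |x| := by
  have h₁ : f ≤ |f| := le_abs_self f
  have h₂ : -f ≤ |f| := neg_le_abs f
  have h₃ : ∀ z : E, 0 ≤ z → |f z| ≤ |f| z := fun z hz => abs_le'.2 ⟨h₁ z hz, h₂ z hz⟩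
  have h₄ : f x = f x⁺ - f x⁻ := by rw [← map_sub, posPart_sub_negPart]
  rw [h₄, ← posPart_add_negPart x, map_add]
  exact (abs_sub _ _).trans (add_le_add (h₃ _ (posPart_nonneg x)) (h₃ _ (negPart_nonneg x)))

theorem abs_apply_le_of_forall (f : StrongDual ℝ E) {x : E} (hx : 0 ≤ x) {c : ℝ}
    (h : ∀ y : E, |y| ≤ x → f y ≤ c) : |f| x ≤ c := by
  change (-f) x + dualPos (f - -f) x ≤ c
  rw [dualPos_apply _ hx]
  have h₁ : posVal (f - -f) x ≤ c + f x := by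
    refine posVal_le _ hx fun y hy => ?_
    have h₂ := h (y + y - x) (abs_le'.2 ⟨?_, ?_⟩)
    · rw [map_sub, map_add] at h₂
      change f y - -f y ≤ _
      linarith
    · rw [sub_le_iff_le_add]
      exact add_le_add hy.2 hy.2
    · rw [neg_sub]
      exact sub_le_self x (add_nonneg hy.1 hy.1)
  change -f x + _ ≤ c
  linarith

theorem exists_lt_map_of_lt_abs_apply (f : StrongDual ℝ E) {x : E} (hx : 0 ≤ x) {c : ℝ}
    (h : c < |f| x) : ∃ y : E, |y| ≤ x ∧ c < f y := by
  by_contra! hc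
  exact (abs_apply_le_of_forall f hx hc).not_gt h

instance : HasSolidNorm (StrongDual ℝ E) where
  solid f g h := by
    refine f.opNorm_le_bound (norm_nonneg g) fun x => ?_
    refine (abs_map_le f x).trans ((h _ (abs_nonneg x)).trans ?_)
    refine abs_apply_le_of_forall g (abs_nonneg x) fun y hy => ?_
    refine (le_abs_self _).trans ((g.le_opNorm y).trans ?_)
    exact mul_le_mul_of_nonneg_left (norm_le_norm_of_abs_le_abs hy) (norm_nonneg g)

end DualBanachLattice

section VectorLattice

set_option linter.unusedSectionVars false

variable {E : Type u} [AddCommGroup E] [Lattice E] [IsOrderedAddMonoid E]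

theorem add_inf_le {a b c : E} (ha : 0 ≤ a) (hb : 0 ≤ b) (hc : 0 ≤ c) :
    (a + b) ⊓ c ≤ a ⊓ c + b ⊓ c := by
  rw [← sub_le_iff_le_add']
  have h₁ : 0 ≤ a ⊓ c := le_inf ha hc
  refine le_inf ?_ ((sub_le_self _ h₁).trans inf_le_right)
  rw [sub_le_iff_le_add', ← sub_le_iff_le_add]
  refine le_inf ?_ ((sub_le_self _ hb).trans inf_le_right)
  rw [sub_le_iff_le_add]
  exact inf_le_left

theorem sum_range_le_of_disjoint {a : ℕ → E} (ha : ∀ n, 0 ≤ a n)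
    (hd : Pairwise fun n m => a n ⊓ a m = 0) {b : E} (hb : 0 ≤ b) (h : ∀ n, a n ≤ b) (N : ℕ) :
    ∑ n ∈ Finset.range N, a n ≤ b := by
  have hs : ∀ N, 0 ≤ ∑ n ∈ Finset.range N, a n := fun N => Finset.sum_nonneg fun n _ => ha n
  have hinf : ∀ N m, N ≤ m → (∑ n ∈ Finset.range N, a n) ⊓ a m = 0 := by
    intro N
    induction N with
    | zero => intro m _; rw [Finset.sum_range_zero, inf_eq_left]; exact ha m
    | succ N ih =>
      intro m hm
      rw [Finset.sum_range_succ]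
      refine le_antisymm ((add_inf_le (hs N) (ha N) (ha m)).trans ?_)
        (le_inf (add_nonneg (hs N) (ha N)) (ha m))
      rw [ih m (by omega), hd (by omega : N ≠ m), add_zero]
  induction N with
  | zero => rwa [Finset.sum_range_zero]
  | succ N ih =>
    rw [Finset.sum_range_succ, ← inf_add_sup, hinf N N le_rfl, zero_add]
    exact sup_le ih (h N)

variable [Module ℝ E] [IsOrderedModule ℝ E]

theorem abs_smul_le {c : ℝ} (hc : 0 ≤ c) (x : E) : |c • x| ≤ c • |x| :=
  abs_le'.2 ⟨smul_le_smul_of_nonneg_left (le_abs_self x) hc, by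
    rw [← smul_neg]; exact smul_le_smul_of_nonneg_left (neg_le_abs x) hc⟩

theorem smul_inf_smul_eq_zero {x y : E} (hx : 0 ≤ x) (hy : 0 ≤ y) (h : x ⊓ y = 0) {c : ℝ}
    (hc : 0 ≤ c) : c • x ⊓ c • y = 0 := by
  refine le_antisymm ?_ (le_inf (smul_nonneg hc hx) (smul_nonneg hc hy))
  rcases hc.eq_or_lt with rfl | hc
  · rw [zero_smul]; exact inf_le_left
  · have h₁ : c⁻¹ • (c • x ⊓ c • y) ≤ 0 := by
      rw [← h]
      refine le_inf ?_ ?_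
      · have h₂ := smul_le_smul_of_nonneg_left (inf_le_left : c • x ⊓ c • y ≤ _) (inv_pos.2 hc).le
        rwa [inv_smul_smul₀ hc.ne'] at h₂
      · have h₂ := smul_le_smul_of_nonneg_left (inf_le_right : c • x ⊓ c • y ≤ _) (inv_pos.2 hc).le
        rwa [inv_smul_smul₀ hc.ne'] at h₂
    have h₃ := smul_le_smul_of_nonneg_left h₁ hc.le
    rwa [smul_inv_smul₀ hc.ne', smul_zero] at h₃

end VectorLattice

section DiagonalLemma

/-- A form of the Phillips lemma: if the subseries of the rows of a matrix tend to zero, then so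
does its diagonal. -/
theorem tendsto_diag_of_tendsto_subseries {b : ℕ → ℕ → ℝ} (hb : ∀ k, Summable fun j => |b k j|)
    (h : ∀ s : ℕ → Bool, Tendsto (fun k => ∑' j, if s j then b k j else 0) atTop (𝓝 0)) :
    Tendsto (fun k => b k k) atTop (𝓝 0) := by
  have hsum : ∀ k (s : ℕ → Bool), Summable fun j => if s j then b k j else 0 := fun k s =>
    Summable.of_norm_bounded (hb k) fun j => by split_ifs <;> simp
  rw [Metric.tendsto_atTop]
  intro ε hε
  let F : ℕ → (ℕ → Bool) → ℝ := fun k s => ∑' j, if s j then b k j else 0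
  have hF : ∀ k, Continuous (F k) := fun k => by
    refine continuous_tsum (fun j => ?_) (hb k) fun j s => by split_ifs <;> simp
    exact (continuous_of_discreteTopology (f := fun t : Bool => if t then b k j else 0)).comp
      (continuous_apply j)
  obtain ⟨N, s, hs⟩ := nonempty_interior_of_iUnion_of_closed
    (f := fun N => ⋂ k ≥ N, {s | |F k s| ≤ ε / 3})
    (fun N => isClosed_biInter fun k _ => isClosed_le (hF k).abs continuous_const) (by
      refine Set.eq_univ_of_forall fun s => Set.mem_iUnion.2 ?_
      obtain ⟨N, hN⟩ := Metric.tendsto_atTop.1 (h s) (ε / 3) (by positivity)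
      refine ⟨N, Set.mem_iInter₂.2 fun k hk => ?_⟩
      have h₁ := hN k hk
      rw [Real.dist_eq, sub_zero] at h₁
      exact h₁.le)
  obtain ⟨I, U, hU, hI⟩ := isOpen_pi_iff.1 isOpen_interior s hs
  refine ⟨max N (I.sup id + 1), fun k hk => ?_⟩
  have hkI : k ∉ I := fun hk' => by
    have h₁ : k ≤ I.sup id := Finset.le_sup (f := id) hk'
    have h₂ := le_max_right N (I.sup id + 1)
    omega
  have hmem : ∀ t : Bool, |F k (Function.update s k t)| ≤ ε / 3 := fun t => by
    have h₁ : Function.update s k t ∈ (I : Set ℕ).pi U := fun j hj => by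
      rw [Function.update_of_ne (fun h : j = k => hkI (h ▸ Finset.mem_coe.1 hj))]
      exact (hU j hj).2
    exact Set.mem_iInter₂.1 (interior_subset (hI h₁)) k ((le_max_left _ _).trans hk)
  have hdiff : F k (Function.update s k true) - F k (Function.update s k false) = b k k := by
    change (∑' j, _) - (∑' j, _) = _
    rw [← (hsum k _).tsum_sub (hsum k _), tsum_eq_single k]
    · simp
    · intro j hj
      simp [Function.update_of_ne hj]
  have h₁ := abs_le.1 (hmem true)
  have h₂ := abs_le.1 (hmem false)
  rw [Real.dist_eq, sub_zero, ← hdiff, abs_lt]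
  constructor <;> linarith [h₁.1, h₁.2, h₂.1, h₂.2]

end DiagonalLemma

/-- Hahn–Banach: a sublinear functional is the maximum at each point of the linear functionals
below it. -/
theorem exists_linearMap_eq_of_sublinear {V : Type*} [AddCommGroup V] [Module ℝ V] {p : V → ℝ}
    (hp : ∀ c : ℝ, 0 < c → ∀ x, p (c • x) = c * p x) (hadd : ∀ x y, p (x + y) ≤ p x + p y)
    (a : V) : ∃ g : V →ₗ[ℝ] ℝ, g a = p a ∧ ∀ x, g x ≤ p x := by
  have h0 : p 0 = 0 := by
    have h := hp 2 two_pos 0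
    rw [smul_zero] at h
    linarith
  have H : ∀ c : ℝ, c • a = 0 → (RingHom.id ℝ) c • p a = 0 := fun c hc => by
    rcases smul_eq_zero.1 hc with rfl | rfl
    · exact zero_smul ℝ _
    · rw [h0, smul_zero]
  obtain ⟨g, hg, hgp⟩ := exists_extension_of_le_sublinear
    (LinearPMap.mkSpanSingleton' a (p a) H) p hp hadd (by
      rintro ⟨x, hx⟩
      obtain ⟨c, rfl⟩ := Submodule.mem_span_singleton.1 hx
      rw [LinearPMap.mkSpanSingleton'_apply]
      change c * p a ≤ p (c • a)
      rcases lt_trichotomy c 0 with hc | rfl | hc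
      · have h₁ := hp (-c) (neg_pos.2 hc) a
        have h₂ := hadd (c • a) ((-c) • a)
        rw [← add_smul, add_neg_cancel, zero_smul, h0, h₁] at h₂
        linarith
      · rw [zero_mul, zero_smul, h0]
      · rw [hp c hc a])
  refine ⟨g, ?_, hgp⟩
  have h := hg ⟨a, Submodule.mem_span_singleton_self a⟩
  rw [h]
  exact LinearPMap.mkSpanSingleton'_apply_self a (p a) H _

section DisjointSequences

variable {E : Type u} [NormedAddCommGroup E] [Lattice E] [HasSolidNorm E] [IsOrderedAddMonoid E]
  [NormedSpace ℝ E] [IsOrderedModule ℝ E]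

/-- The value of `f ≥ 0` on the part of `|y|` carried by `x ≥ 0`. -/
noncomputable def carriedPart (f : StrongDual ℝ E) (x y : E) : ℝ := ⨆ k : ℕ, f (|y| ⊓ (k : ℝ) • x)

theorem bddAbove_range_carriedPart {f : StrongDual ℝ E} (hf : 0 ≤ f) (x y : E) :
    BddAbove (Set.range fun k : ℕ => f (|y| ⊓ (k : ℝ) • x)) := by
  refine ⟨f |y|, ?_⟩
  rintro _ ⟨k, rfl⟩
  exact map_mono_of_nonneg hf inf_le_left

theorem le_carriedPart {f : StrongDual ℝ E} (hf : 0 ≤ f) {x y : E} (k : ℕ) :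
    f (|y| ⊓ (k : ℝ) • x) ≤ carriedPart f x y :=
  le_ciSup (bddAbove_range_carriedPart hf x y) k

theorem map_le_carriedPart {f : StrongDual ℝ E} (hf : 0 ≤ f) {x y : E} (h : x ≤ |y|) :
    f x ≤ carriedPart f x y := by
  have h₁ := le_carriedPart hf (x := x) (y := y) 1
  rwa [Nat.cast_one, one_smul, inf_eq_right.2 h] at h₁

theorem carriedPart_add_le {f : StrongDual ℝ E} (hf : 0 ≤ f) {x : E} (hx : 0 ≤ x) (y z : E) :
    carriedPart f x (y + z) ≤ carriedPart f x y + carriedPart f x z := by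
  refine ciSup_le fun k => ?_
  have h : |y + z| ⊓ (k : ℝ) • x ≤ |y| ⊓ (k : ℝ) • x + |z| ⊓ (k : ℝ) • x :=
    (inf_le_inf_right _ (abs_add_le y z)).trans
      (add_inf_le (abs_nonneg y) (abs_nonneg z) (smul_nonneg k.cast_nonneg hx))
  refine (map_mono_of_nonneg hf h).trans ?_
  rw [map_add]
  exact add_le_add (le_carriedPart hf k) (le_carriedPart hf k)

theorem carriedPart_smul {f : StrongDual ℝ E} (hf : 0 ≤ f) {x : E} (hx : 0 ≤ x) {c : ℝ}
    (hc : 0 < c) (y : E) : carriedPart f x (c • y) = c * carriedPart f x y := by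
  have key : ∀ {c : ℝ}, 0 < c → ∀ y, carriedPart f x (c • y) ≤ c * carriedPart f x y := by
    intro c hc y
    refine ciSup_le fun k => ?_
    obtain ⟨m, hm⟩ := exists_nat_ge (c⁻¹ * k)
    have h₁ : c⁻¹ • (|c • y| ⊓ (k : ℝ) • x) ≤ |y| ⊓ (m : ℝ) • x := by
      refine le_inf ?_ ?_
      · have h := smul_le_smul_of_nonneg_left
          ((inf_le_left : |c • y| ⊓ (k : ℝ) • x ≤ _).trans (abs_smul_le hc.le y)) (inv_pos.2 hc).le
        rwa [inv_smul_smul₀ hc.ne'] at h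
      · refine (smul_le_smul_of_nonneg_left inf_le_right (inv_pos.2 hc).le).trans ?_
        rw [smul_smul]
        exact smul_le_smul_of_nonneg_right hm hx
    have h₂ := (map_mono_of_nonneg hf h₁).trans (le_carriedPart hf m)
    rwa [map_smul, smul_eq_mul, inv_mul_le_iff₀ hc] at h₂
  refine le_antisymm (key hc y) ?_
  have h := key (inv_pos.2 hc) (c • y)
  rwa [inv_smul_smul₀ hc.ne', le_inv_mul_iff₀ hc] at h

theorem sum_carriedPart_le {f : StrongDual ℝ E} (hf : 0 ≤ f) {x : ℕ → E} (hx : ∀ n, 0 ≤ x n)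
    (hd : Pairwise fun n m => x n ⊓ x m = 0) (y : E) (N : ℕ) :
    ∑ n ∈ Finset.range N, carriedPart f (x n) y ≤ f |y| := by
  have hlim : ∀ n, Tendsto (fun k : ℕ => f (|y| ⊓ (k : ℝ) • x n)) atTop
      (𝓝 (carriedPart f (x n) y)) := fun n =>
    tendsto_atTop_ciSup (fun k l hkl => map_mono_of_nonneg hf (inf_le_inf_left _
      (smul_le_smul_of_nonneg_right (Nat.cast_le.2 hkl) (hx n))))
      (bddAbove_range_carriedPart hf (x n) y)
  refine le_of_tendsto' (tendsto_finsetSum _ fun n _ => hlim n) fun k => ?_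
  rw [← map_sum]
  have hk : ∀ n, 0 ≤ (k : ℝ) • x n := fun n => smul_nonneg k.cast_nonneg (hx n)
  refine map_mono_of_nonneg hf (sum_range_le_of_disjoint
    (fun n => le_inf (abs_nonneg y) (hk n)) (fun n m hnm => ?_) (abs_nonneg y)
    (fun n => inf_le_left) N)
  refine le_antisymm ((inf_le_inf inf_le_right inf_le_right).trans ?_)
    (le_inf (le_inf (abs_nonneg y) (hk n)) (le_inf (abs_nonneg y) (hk m)))
  rw [smul_inf_smul_eq_zero (hx n) (hx m) (hd hnm) k.cast_nonneg]

theorem tendsto_map_of_disjoint_of_tendsto {f : StrongDual ℝ E} (hf : 0 ≤ f) {x y : ℕ → E}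
    (hx : ∀ n, 0 ≤ x n) (hd : Pairwise fun n m => x n ⊓ x m = 0) (hxy : ∀ n, x n ≤ |y n|) {a : E}
    (hy : ∀ g : StrongDual ℝ E, Tendsto (fun n => g (y n)) atTop (𝓝 (g a))) :
    Tendsto (fun n => f (x n)) atTop (𝓝 0) := by
  choose h hh hle using fun n => exists_linearMap_eq_of_sublinear
    (p := carriedPart f (x n)) (fun c hc y => carriedPart_smul hf (hx n) hc y)
    (carriedPart_add_le hf (hx n)) (y n)
  have habs : ∀ n z, |h n z| ≤ carriedPart f (x n) z := fun n z => by
    refine abs_le'.2 ⟨hle n z, ?_⟩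
    have h₁ := hle n (-z)
    rw [map_neg] at h₁
    simpa only [carriedPart, abs_neg] using h₁
  have hsum : ∀ z N, ∑ n ∈ Finset.range N, |h n z| ≤ f |z| := fun z N =>
    (Finset.sum_le_sum fun n _ => habs n z).trans (sum_carriedPart_le hf hx hd z N)
  have hs : ∀ z, Summable fun n => |h n z| := fun z =>
    summable_of_sum_range_le (fun _ => abs_nonneg _) (hsum z)
  have hs' : ∀ (s : ℕ → Bool) z, Summable fun n => |if s n then h n z else 0| := fun s z =>
    Summable.of_nonneg_of_le (fun _ => abs_nonneg _) (fun n => by split_ifs <;> simp) (hs z)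
  let H : (ℕ → Bool) → StrongDual ℝ E := fun s => LinearMap.mkContinuous
    { toFun := fun z => ∑' n, if s n then h n z else 0
      map_add' := fun z w => by
        rw [← (hs' s z).of_abs.tsum_add (hs' s w).of_abs]
        refine tsum_congr fun n => ?_
        split_ifs
        · exact map_add (h n) z w
        · rw [add_zero]
      map_smul' := fun c z => by
        rw [RingHom.id_apply, smul_eq_mul, ← tsum_mul_left]
        refine tsum_congr fun n => ?_
        split_ifs
        · exact map_smul (h n) c z
        · rw [mul_zero] } ‖f‖ fun z => by
      have h₁ : ‖∑' n, if s n then h n z else 0‖ ≤ ∑' n, |if s n then h n z else 0| :=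
        norm_tsum_le_tsum_norm (hs' s z)
      have h₂ : ∑' n, |if s n then h n z else 0| ≤ ∑' n, |h n z| :=
        (hs' s z).tsum_le_tsum (fun n => by split_ifs <;> simp) (hs z)
      have h₃ : ∑' n, |h n z| ≤ f |z| := (hs z).tsum_le_of_sum_range_le (hsum z)
      have h₄ : f |z| ≤ ‖f‖ * ‖z‖ := by
        rw [← norm_abs_eq_norm z]
        exact (le_abs_self _).trans (f.le_opNorm _)
      exact h₁.trans (h₂.trans (h₃.trans h₄))
  have hdiag : Tendsto (fun k => h k (y k - a)) atTop (𝓝 0) := by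
    refine tendsto_diag_of_tendsto_subseries (b := fun k j => h j (y k - a))
      (fun k => hs (y k - a)) fun s => ?_
    have h₁ := (hy (H s)).sub_const (H s a)
    rw [sub_self] at h₁
    refine h₁.congr fun k => ?_
    rw [← map_sub]
    rfl
  have ha : Tendsto (fun k => h k a) atTop (𝓝 0) := (hs a).of_abs.tendsto_atTop_zero
  have hlim := hdiag.add ha
  rw [add_zero] at hlim
  refine squeeze_zero (fun n => ?_) (fun n => ?_) hlim
  · have h₁ := map_mono_of_nonneg hf (hx n)
    rwa [map_zero] at h₁
  · rw [← map_add, sub_add_cancel, hh]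
    exact map_le_carriedPart hf (hxy n)

/-- Disjoint sequences in the solid hull of a relatively weakly compact set have weakly null
moduli. -/
theorem IsDisjointSeq.isWeaklyNull_abs {x y : ℕ → E} (hd : IsDisjointSeq x) {A : Set E}
    (hA : IsRelativelyWeaklyCompact A) (hy : ∀ n, y n ∈ A) (hxy : ∀ n, |x n| ≤ |y n|) :
    IsWeaklyNull fun n => |x n| := by
  intro φ
  have key : Tendsto (fun n => |φ| |x n|) atTop (𝓝 0) := by
    refine tendsto_of_subseq_tendsto fun ns hns => ?_
    obtain ⟨ks, -, hks⟩ := strictMono_subseq_of_tendsto_atTop hns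
    obtain ⟨a, ms, hms, ha⟩ := hA.exists_subseq (x := fun n => y (ns (ks n))) fun n => hy _
    refine ⟨ks ∘ ms, tendsto_map_of_disjoint_of_tendsto (abs_nonneg φ) (fun n => abs_nonneg _)
      (fun n m hnm => ?_) (fun n => hxy _) ha⟩
    exact hd fun h => hnm (hms.injective (hks.injective h))
  refine squeeze_zero_norm (fun n => ?_) key
  have h := abs_map_le φ |x n|
  rwa [abs_abs] at h

theorem IsDisjointSeq.isWeaklyNull {x y : ℕ → E} (hd : IsDisjointSeq x) {A : Set E}
    (hA : IsRelativelyWeaklyCompact A) (hy : ∀ n, y n ∈ A) (hxy : ∀ n, |x n| ≤ |y n|) :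
    IsWeaklyNull x := fun φ =>
  squeeze_zero_norm (fun n => abs_map_le φ (x n)) (hd.isWeaklyNull_abs hA hy hxy |φ|)

/-- If no order interval almost absorbs the bounded set `A` with respect to the positive
functionals in `B`, then this is witnessed by a disjoint sequence in the solid hull of `A`. -/
theorem exists_disjointSeq_of_not_almost_order_bounded [CompleteSpace E] {A : Set E}
    {B : Set (StrongDual ℝ E)} {M C ε : ℝ} (hA : ∀ x ∈ A, ‖x‖ ≤ M) (hB : ∀ f ∈ B, ‖f‖ ≤ C)
    (hB' : ∀ f ∈ B, 0 ≤ f) (hε : 0 < ε)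
    (h : ∀ w : E, 0 ≤ w → ∃ x ∈ A, ∃ f ∈ B, ε < f (|x| - w)⁺) :
    ∃ (v x : ℕ → E) (f : ℕ → StrongDual ℝ E), IsDisjointSeq v ∧ (∀ n, 0 ≤ v n) ∧
      (∀ n, x n ∈ A) ∧ (∀ n, v n ≤ |x n|) ∧ (∀ n, f n ∈ B) ∧
      ∀ᶠ n in atTop, ε / 2 < f n (v n) := by
  choose! X hXA F hFB hXF using h
  let s : ℕ → E := fun n => Nat.rec 0 (fun n t => t + |X ((4 : ℝ) ^ n • t)|) n
  let x : ℕ → E := fun n => X ((4 : ℝ) ^ n • s n)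
  have hs0 : s 0 = 0 := rfl
  have hs1 : ∀ n, s (n + 1) = s n + |x n| := fun n => rfl
  have hs : ∀ n, 0 ≤ s n := by
    intro n
    induction n with
    | zero => exact le_rfl
    | succ n ih => rw [hs1]; exact add_nonneg ih (abs_nonneg _)
  have hw : ∀ n, 0 ≤ (4 : ℝ) ^ n • s n := fun n => smul_nonneg (by positivity) (hs n)
  have hsx : ∀ m n, m < n → |x m| ≤ s n := by
    intro m n hmn
    induction n, hmn using Nat.le_induction with
    | base => rw [hs1]; exact le_add_of_nonneg_left (hs m)
    | succ n _ ih => rw [hs1]; exact ih.trans (le_add_of_nonneg_right (abs_nonneg _))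
  have hxA : ∀ n, x n ∈ A := fun n => hXA _ (hw n)
  have hsm : Summable fun n => ((1 : ℝ) / 2) ^ n • |x n| := by
    refine Summable.of_norm_bounded (summable_geometric_two.mul_right M) fun n => ?_
    rw [norm_smul, norm_abs_eq_norm, Real.norm_of_nonneg (by positivity)]
    exact mul_le_mul_of_nonneg_left (hA _ (hxA n)) (by positivity)
  have hpos : ∀ n, 0 ≤ ((1 : ℝ) / 2) ^ n • |x n| := fun n => smul_nonneg (by positivity) (abs_nonneg _)
  set y : E := ∑' n, ((1 : ℝ) / 2) ^ n • |x n|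
  have hy0 : 0 ≤ y := tsum_nonneg hpos
  have hyx : ∀ n, ((1 : ℝ) / 2) ^ n • |x n| ≤ y := fun n => hsm.le_tsum n fun m _ => hpos m
  let r : ℕ → E := fun n => ((1 : ℝ) / 2) ^ n • y
  have hr : ∀ n, 0 ≤ r n := fun n => smul_nonneg (by positivity) hy0
  let v : ℕ → E := fun n => (|x n| - (4 : ℝ) ^ n • s n - r n)⁺
  have hv : ∀ n, 0 ≤ v n := fun n => posPart_nonneg _
  have hdisj : ∀ m n, m < n → v m ⊓ v n = 0 := by
    intro m n hmn
    set d : E := |x n| - (4 : ℝ) ^ n • |x m| with hd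
    have h₁ : v n ≤ d⁺ := by
      refine posPart_mono ((sub_le_self _ (hr n)).trans (sub_le_sub_left ?_ _))
      exact smul_le_smul_of_nonneg_left (hsx m n hmn) (by positivity)
    have h₂ : v m ≤ d⁻ := by
      refine sup_le ?_ (negPart_nonneg d)
      have h4 : (0 : ℝ) < (4 : ℝ) ^ n := by positivity
      have h₃ : ((4 : ℝ) ^ n)⁻¹ • |x n| ≤ r m := by
        have h₄ := smul_le_smul_of_nonneg_left (hyx n) (by positivity : (0 : ℝ) ≤ (1 / 2) ^ m)
        refine le_trans ?_ h₄
        rw [smul_smul]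
        refine smul_le_smul_of_nonneg_right ?_ (abs_nonneg _)
        rw [← pow_add, ← inv_pow, show (4 : ℝ)⁻¹ = (1 / 2) ^ 2 by norm_num, ← pow_mul]
        exact pow_le_pow_of_le_one (by norm_num) (by norm_num) (by omega)
      have h₅ : |x m| - (4 : ℝ) ^ m • s m - r m ≤ ((4 : ℝ) ^ n)⁻¹ • (-d) := by
        rw [hd, neg_sub, smul_sub, inv_smul_smul₀ h4.ne']
        exact sub_le_sub (sub_le_self _ (hw m)) h₃
      refine h₅.trans ((smul_le_smul_of_nonneg_left (neg_le_negPart d) (inv_pos.2 h4).le).trans ?_)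
      have h₆ := smul_le_smul_of_nonneg_right (inv_le_one_of_one_le₀ (one_le_pow₀ (by norm_num) :
        (1 : ℝ) ≤ 4 ^ n)) (negPart_nonneg d)
      rwa [one_smul] at h₆
    refine le_antisymm ((inf_le_inf h₂ h₁).trans ?_) (le_inf (hv m) (hv n))
    rw [inf_comm, posPart_inf_negPart_eq_zero]
  refine ⟨v, x, fun n => F ((4 : ℝ) ^ n • s n), fun m n hmn => ?_, hv, hxA, fun n => ?_,
    fun n => hFB _ (hw n), ?_⟩
  · change |v m| ⊓ |v n| = 0
    rw [abs_of_nonneg (hv m), abs_of_nonneg (hv n)]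
    rcases lt_or_gt_of_ne hmn with h | h
    · exact hdisj m n h
    · rw [inf_comm]; exact hdisj n m h
  · exact sup_le ((sub_le_self _ (hr n)).trans (sub_le_self _ (hw n))) (abs_nonneg _)
  · have hlim : Tendsto (fun n : ℕ => ((1 : ℝ) / 2) ^ n * (C * ‖y‖)) atTop (𝓝 0) := by
      have h₁ := (tendsto_pow_atTop_nhds_zero_of_lt_one (by norm_num : (0 : ℝ) ≤ 1 / 2)
        (by norm_num)).mul_const (C * ‖y‖)
      rwa [zero_mul] at h₁
    filter_upwards [hlim.eventually_lt_const (half_pos hε)] with n hn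
    set f := F ((4 : ℝ) ^ n • s n)
    have hf : f ∈ B := hFB _ (hw n)
    have h₁ : ε < f (|x n| - (4 : ℝ) ^ n • s n)⁺ := hXF _ (hw n)
    have h₂ : (|x n| - (4 : ℝ) ^ n • s n)⁺ ≤ v n + r n := by
      refine sup_le ?_ (add_nonneg (hv n) (hr n))
      rw [← sub_le_iff_le_add]
      exact le_posPart _
    have h₃ := map_mono_of_nonneg (hB' f hf) h₂
    rw [map_add] at h₃
    have h₄ : f (r n) ≤ ((1 : ℝ) / 2) ^ n * (C * ‖y‖) := by
      change f (((1 : ℝ) / 2) ^ n • y) ≤ _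
      rw [map_smul, smul_eq_mul]
      refine mul_le_mul_of_nonneg_left ?_ (by positivity)
      exact (le_abs_self _).trans (f.le_of_opNorm_le (hB f hf) y)
    linarith

end DisjointSequences

section Equivalence

variable {E : Type u} [NormedAddCommGroup E] [Lattice E] [HasSolidNorm E] [IsOrderedAddMonoid E]
  [NormedSpace ℝ E] [IsOrderedModule ℝ E]

theorem HasWeakDunfordPettisProperty.exists_posPart_abs_sub_le [CompleteSpace E]
    (hE : HasWeakDunfordPettisProperty.{u, v} E) {A : Set E} {B : Set (StrongDual ℝ E)}
    (hA : IsRelativelyWeaklyCompact A) (hB : IsRelativelyWeaklyCompact B) {ε : ℝ} (hε : 0 < ε) :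
    ∃ w : E, 0 ≤ w ∧ ∀ x ∈ A, ∀ f ∈ B, |f| ((|x| - w)⁺) ≤ ε := by
  by_contra! hcon
  obtain ⟨M, hM⟩ := hA.exists_norm_le
  obtain ⟨C, hC⟩ := hB.exists_norm_le
  obtain ⟨v, x, F, hd, hv, hxA, hvx, hFB, hF⟩ := exists_disjointSeq_of_not_almost_order_bounded
    (A := A) (B := (fun f => |f|) '' B) (M := M) (C := C) hM
    (by rintro _ ⟨f, hf, rfl⟩; exact (norm_abs_eq_norm f).trans_le (hC f hf))
    (by rintro _ ⟨f, hf, rfl⟩; exact abs_nonneg f) hε (fun w hw => by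
      obtain ⟨x, hx, f, hf, h⟩ := hcon w hw
      exact ⟨x, hx, |f|, ⟨f, hf, rfl⟩, h⟩)
  choose f hfB hfF using hFB
  have hy : ∀ n, ∃ y : E, |y| ≤ v n ∧ |f n| (v n) - ε / 4 < f n y := fun n =>
    exists_lt_map_of_lt_abs_apply (f n) (hv n) (sub_lt_self _ (by positivity))
  choose y hyv hfy using hy
  have hdy : IsDisjointSeq y := fun n m hnm => by
    have h := hd hnm
    simp only [abs_of_nonneg (hv _)] at h
    exact le_antisymm ((inf_le_inf (hyv n) (hyv m)).trans h.le)
      (le_inf (abs_nonneg _) (abs_nonneg _))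
  obtain ⟨g, ψ, hψ, hg⟩ := hB.exists_subseq hfB
  have hdψ : IsDisjointSeq fun n => y (ψ n) := fun n m hnm =>
    hdy fun h => hnm (hψ.injective h)
  have hyψ : IsWeaklyNull fun n => y (ψ n) :=
    hdψ.isWeaklyNull hA (fun n => hxA (ψ n)) fun n => (hyv _).trans (hvx _)
  have hfψ : IsWeaklyNull fun n => f (ψ n) - g := fun Φ => by
    have h := (hg Φ).sub_const (Φ g)
    rw [sub_self] at h
    exact h.congr fun n => (map_sub Φ _ _).symm
  have hlim := (hE.tendsto_eval hfψ hdψ hyψ).add (hyψ g)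
  rw [add_zero] at hlim
  have h₁ := hlim.eventually_lt_const (by positivity : 0 < ε / 4)
  have h₂ := hψ.tendsto_atTop.eventually hF
  obtain ⟨n, h₁, h₂⟩ := (h₁.and h₂).exists
  have h₃ := hfy (ψ n)
  have h₄ : F (ψ n) (v (ψ n)) = |f (ψ n)| (v (ψ n)) := by rw [← hfF]
  have h₅ : (f (ψ n) - g) (y (ψ n)) + g (y (ψ n)) = f (ψ n) (y (ψ n)) := sub_add_cancel _ _
  linarith

theorem exists_posPart_abs_sub_apply_le {A : Set E} {B : Set (StrongDual ℝ E)}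
    (hA : IsRelativelyWeaklyCompact A) (hB : IsRelativelyWeaklyCompact B)
    (h : ∀ ε : ℝ, 0 < ε → ∃ w : E, 0 ≤ w ∧ ∀ x ∈ A, ∀ f ∈ B, |f| ((|x| - w)⁺) ≤ ε)
    {ε : ℝ} (hε : 0 < ε) :
    ∃ g : StrongDual ℝ E, 0 ≤ g ∧ ∀ x ∈ A, ∀ f ∈ B, ((|f| - g)⁺) |x| ≤ ε := by
  by_contra! hcon
  obtain ⟨M, hM⟩ := hA.exists_norm_le
  obtain ⟨C, hC⟩ := hB.exists_norm_le
  obtain ⟨φ, f, Θ, hd, hφ, hfB, hφf, hΘ, hlt⟩ := exists_disjointSeq_of_not_almost_order_bounded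
    (A := B) (B := (fun x : E => NormedSpace.inclusionInDoubleDual ℝ E |x|) '' A)
    (M := C) (C := M) hC
    (by
      rintro _ ⟨x, hx, rfl⟩
      refine (NormedSpace.double_dual_bound ℝ E |x|).trans ?_
      rw [norm_abs_eq_norm]
      exact hM x hx)
    (by rintro _ ⟨x, hx, rfl⟩ f hf; exact hf _ (abs_nonneg x)) hε (fun g hg => by
      obtain ⟨x, hx, f, hf, h⟩ := hcon g hg
      exact ⟨f, hf, _, ⟨x, hx, rfl⟩, h⟩)
  choose x hxA hxΘ using hΘ
  have hval : ∀ n (g : StrongDual ℝ E), Θ n g = g |x n| := fun n g => by rw [← hxΘ]; rfl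
  obtain ⟨w, hw, hwle⟩ := h (ε / 4) (by positivity)
  have hnull : IsWeaklyNull φ := hd.isWeaklyNull hB hfB fun n => by
    rw [abs_of_nonneg (hφ n)]; exact hφf n
  have h₁ := (hnull (NormedSpace.inclusionInDoubleDual ℝ E w)).eventually_lt_const
    (by positivity : 0 < ε / 4)
  obtain ⟨n, h₁, h₂⟩ := (h₁.and hlt).exists
  rw [hval] at h₂
  have h₃ : |x n| ≤ (|x n| - w)⁺ + w := by
    rw [← sub_le_iff_le_add]
    exact le_posPart _
  have h₄ := map_mono_of_nonneg (hφ n) h₃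
  rw [map_add] at h₄
  have h₅ : φ n (|x n| - w)⁺ ≤ |f n| (|x n| - w)⁺ := hφf n _ (posPart_nonneg _)
  have h₆ := hwle _ (hxA n) _ (hfB n)
  have h₇ : φ n w < ε / 4 := h₁
  linarith

theorem hasWeakDunfordPettisProperty_of_exists_posPart_abs_sub_apply_le
    (h : ∀ (A : Set E) (B : Set (StrongDual ℝ E)),
      IsRelativelyWeaklyCompact A → IsRelativelyWeaklyCompact B → ∀ ε : ℝ, 0 < ε →
        ∃ g : StrongDual ℝ E, 0 ≤ g ∧ ∀ x ∈ A, ∀ f ∈ B, ((|f| - g)⁺) |x| ≤ ε) :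
    HasWeakDunfordPettisProperty.{u, v} E := by
  intro Y _ _ _ T hT x hd hx
  have hA := hx.isRelativelyWeaklyCompact_range
  choose G hG hGT using fun n => exists_dual_vector'' ℝ (T (x n))
  rw [Metric.tendsto_atTop]
  intro ε hε
  obtain ⟨g, hg, hgle⟩ := h _ _ hA hT.adjoint (ε / 2) (half_pos hε)
  have hnull := hd.isWeaklyNull_abs hA (fun n => ⟨n, rfl⟩) fun n => le_rfl
  obtain ⟨N, hN⟩ := eventually_atTop.1 ((hnull g).eventually_lt_const (half_pos hε))
  refine ⟨N, fun n hn => ?_⟩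
  rw [Real.dist_eq, sub_zero, abs_of_nonneg (norm_nonneg _)]
  have h₁ : ‖T (x n)‖ = (G n ∘L T) (x n) := (hGT n).symm
  have h₂ := (le_abs_self _).trans (abs_map_le (G n ∘L T) (x n))
  have h₃ : |G n ∘L T| ≤ (|G n ∘L T| - g)⁺ + g := by
    rw [← sub_le_iff_le_add]
    exact le_posPart _
  have h₄ : |G n ∘L T| |x n| ≤ (|G n ∘L T| - g)⁺ |x n| + g |x n| := h₃ _ (abs_nonneg _)
  have h₅ := hgle (x n) ⟨n, rfl⟩ (G n ∘L T) ⟨G n, by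
    exact (mem_closedBall_zero_iff (E := StrongDual ℝ Y)).2 (hG n), rfl⟩
  have h₆ := hN n hn
  linarith

end Equivalence

end BanachLattice

theorem corollary2p7 (E : Type u) [NormedAddCommGroup E] [Lattice E] [HasSolidNorm E]
    [IsOrderedAddMonoid E] [NormedSpace ℝ E] [IsOrderedModule ℝ E] [CompleteSpace E] :
    List.TFAE
      [ BanachLattice.HasWeakDunfordPettisProperty.{u, v} E,
        ∀ (A : Set E) (B : Set (StrongDual ℝ E)),
          BanachLattice.IsRelativelyWeaklyCompact A → BanachLattice.IsRelativelyWeaklyCompact B →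
          ∀ ε : ℝ, 0 < ε → ∃ w : E, 0 ≤ w ∧
            ∀ x ∈ A, ∀ f ∈ B, |f| ((|x| - w)⁺) ≤ ε,
        ∀ (A : Set E) (B : Set (StrongDual ℝ E)),
          BanachLattice.IsRelativelyWeaklyCompact A → BanachLattice.IsRelativelyWeaklyCompact B →
          ∀ ε : ℝ, 0 < ε → ∃ g : StrongDual ℝ E, 0 ≤ g ∧
            ∀ x ∈ A, ∀ f ∈ B, ((|f| - g)⁺) |x| ≤ ε ] := by
  tfae_have 1 → 2 := fun h A B hA hB ε hε => h.exists_posPart_abs_sub_le hA hB hε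
  tfae_have 2 → 3 := fun h A B hA hB ε hε =>
    BanachLattice.exists_posPart_abs_sub_apply_le hA hB (h A B hA hB) hε
  tfae_have 3 → 1 :=
    BanachLattice.hasWeakDunfordPettisProperty_of_exists_posPart_abs_sub_apply_le
  tfae_finish
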